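/- Let $\kappa\in\mathbb{R}$ and let $(X,d)$ be a $\mathrm{CBB}(\kappa)$ space, i.e. an Alexandrov space of curvature $\ge\kappa$. Then $\operatorname{Curv} X\ge\kappa$. Here the notions are as follows. - $(M_\kappa,d_\kappa)$ is the model plane of constant curvature $\kappa$: the round sphere of radius $1/\sqrt{\kappa}$ with its intrinsic metric if $\kappa>0$, the Euclidean plane if $\kappa=0$, and the hyperbolic plane with its distance multiplied by $1/\sqrt{-\kappa}$ if $\kappa<0$. A triangle in a metric space is a triple of points; it is called large if $\kappa>0$ and its perimeter is at least $2\pi/\sqrt{\kappa}$. A comparison triangle of a triangle $(a_1,a_2,a_3)$ in $X$ is a triangle $(\overline a_1,\overline a_2,\overline a_3)$ in $M_\kappa$ with $d_\kappa(\overline a_i,\overline a_j)=d(a_i,a_j)$ for all $i,j$; if $(a_1,a_2,a_3)$ is not large, it exists and is unique up to isometries. - $(X,d)$ is a $\mathrm{CBB}(\kappa)$ space if it is a length space (the distance of two points is the infimum of the lengths of the paths joining them) and, for every quadruple $(p;x_1,x_2,x_3)$ of points of $X$ with $p\ne x_i$ for all $i$ such that none of the triangles $(p,x_i,x_j)$,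 $i<j$, is large, one has $$\widetilde\angle_\kappa(p;x_1,x_2)+\widetilde\angle_\kappa(p;x_2,x_3)+\widetilde\angle_\kappa(p;x_3,x_1)\le 2\pi,$$ where $\widetilde\angle_\kappa(p;x,y)$ is the angle at $\overline p$ of a comparison triangle $(\overline p,\overline x,\overline y)$ in $M_\kappa$ of $(p,x,y)$. Completeness is not required. - The circumradius of a triangle $(a_1,a_2,a_3)$ in a metric space $Y$ is $$r(a_1,a_2,a_3)=\inf_{x\in Y}\max_{i=1,2,3} d_Y(x,a_i).$$ - $\operatorname{Curv}X\ge\kappa$ means that, for every triangle $(a_1,a_2,a_3)$ in $X$ that is not large and every comparison triangle $(\overline a_1,\overline a_2,\overline a_3)$ of it in $M_\kappa$, $$r(\overline a_1,\overline a_2,\overline a_3)\le r(a_1,a_2,a_3).$$ -/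

import Mathlib

/-- The model plane `M_κ` of constant curvature `κ`: the simply connected complete surface of
constant curvature `κ`, realised inside `ℝ × ℝ²` by the equation `t² + κ ‖v‖² = 1`, taking the
sheet `t > 0` when `κ ≤ 0`.
* For `κ > 0`, `(t, v) ↦ (t / √κ, v)` identifies it with the round sphere of radius `1 / √κ`.
* For `κ = 0`, one has `t = 1`, and it is the Euclidean plane.
* For `κ < 0`, `(t, v) ↦ (t, √(-κ) v)` identifies it with the upper sheet of the unit
  hyperboloid. -/
structure ModelPlane (κ : ℝ) where
  t : ℝ
  v : EuclideanSpace ℝ (Fin 2)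
  eqn : t ^ 2 + κ * ‖v‖ ^ 2 = 1
  pos : κ ≤ 0 → 0 < t

/-- The intrinsic distance `d_κ` of the model plane: `1 / √κ` times the angular distance on the
unit sphere for `κ > 0`, the Euclidean distance for `κ = 0`, and `1 / √(-κ)` times the hyperbolic
distance of the hyperboloid model for `κ < 0`. -/
noncomputable instance ModelPlane.instDist (κ : ℝ) : Dist (ModelPlane κ) where
  dist P Q :=
    if 0 < κ then Real.arccos (P.t * Q.t + κ * inner ℝ P.v Q.v) / √κ
    else if κ = 0 then ‖P.v - Q.v‖
    else Real.arcosh (P.t * Q.t + κ * inner ℝ P.v Q.v) / √(-κ)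

/-- The triangle `(a, b, c)` is not large for curvature `κ`: there is no restriction for `κ ≤ 0`,
and its perimeter is less than `2π / √κ` for `κ > 0`. -/
def IsSmallTriangle {X : Type*} [Dist X] (κ : ℝ) (a b c : X) : Prop :=
  0 < κ → dist a b + dist b c + dist c a < 2 * Real.pi / √κ

/-- `(a', b', c')` is a comparison triangle in `M_κ` for the triangle `(a, b, c)` in `X`. -/
def IsComparisonTriangle {X : Type*} [Dist X] (κ : ℝ) (a b c : X) (a' b' c' : ModelPlane κ) :
    Prop :=
  dist a' b' = dist a b ∧ dist b' c' = dist b c ∧ dist c' a' = dist c a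

/-- The circumradius `inf_x max (d(x, a), d(x, b), d(x, c))` of the triangle `(a, b, c)`. -/
noncomputable def circumradius {X : Type*} [Dist X] (a b c : X) : ℝ :=
  ⨅ x : X, max (dist x a) (max (dist x b) (dist x c))

/-- `Curv X ≥ κ`: every triangle of `X` (large ones being excluded if `κ > 0`) has circumradius at
least the circumradius of its comparison triangle in `M_κ`. -/
def CurvGE (κ : ℝ) (X : Type*) [MetricSpace X] : Prop :=
  ∀ a b c : X, IsSmallTriangle κ a b c →
    ∀ a' b' c' : ModelPlane κ, IsComparisonTriangle κ a b c a' b' c' →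
      circumradius a' b' c' ≤ circumradius a b c

/-- The model angle at `p` of the triple `(p, x, y)`: the angle at the vertex corresponding to `p`
of the comparison triangle in `M_κ`, given by the law of cosines in `M_κ`. It is meaningful
when `p ≠ x`, `p ≠ y` and `(p, x, y)` is not large. -/
noncomputable def modelAngle {X : Type*} [Dist X] (κ : ℝ) (p x y : X) : ℝ :=
  let a := dist x y
  let b := dist p x
  let c := dist p y
  if 0 < κ then
    Real.arccos ((Real.cos (√κ * a) - Real.cos (√κ * b) * Real.cos (√κ * c)) /
      (Real.sin (√κ * b) * Real.sin (√κ * c)))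
  else if κ = 0 then
    Real.arccos ((b ^ 2 + c ^ 2 - a ^ 2) / (2 * b * c))
  else
    Real.arccos ((Real.cosh (√(-κ) * b) * Real.cosh (√(-κ) * c) - Real.cosh (√(-κ) * a)) /
      (Real.sinh (√(-κ) * b) * Real.sinh (√(-κ) * c)))

/-- Length spaces: the distance of two points is the infimum of the lengths (total variations) of
the paths that join them. -/
def IsLengthSpace (X : Type*) [MetricSpace X] : Prop :=
  ∀ x y : X, edist x y = ⨅ γ : Path x y, eVariationOn γ Set.univ

/-- `X` is a `CBB(κ)` space (an Alexandrov space of curvature `≥ κ`): a length space in which, for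
every quadruple `(p; x, y, z)`, the three model angles at `p` add up to at most `2π` whenever all
three of them are defined. Completeness is not required. -/
structure IsCBB (κ : ℝ) (X : Type*) [MetricSpace X] : Prop where
  isLengthSpace : IsLengthSpace X
  four_point : ∀ p x y z : X, p ≠ x → p ≠ y → p ≠ z →
    IsSmallTriangle κ p x y → IsSmallTriangle κ p y z → IsSmallTriangle κ p z x →
      modelAngle κ p x y + modelAngle κ p y z + modelAngle κ p z x ≤ 2 * Real.pi

/-! It suffices to show that if `x` lies within `R` of the three vertices `p i`, some point `P` of
the model plane lies within `R` of the comparison vertices `q i`; the infimum over `x` then gives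
the claim.

The law of cosines turns model angles at `x` into entries of a matrix `G`: `form (q i) (q j) - c i *
c j` with `c i` the cosine of the scaled distance to `p i` if `κ > 0`, the negative of this with
cosh if `κ < 0`, and `(r i ^ 2 + r j ^ 2 - d ^ 2) / 2` if `κ = 0`. Since the angles add up to at
most `2π`, `G` dominates entrywise the Gram matrix of three plane vectors, so it is copositive:
nonnegative on nonnegative weights (`copositive_of_angle_sum_le`).

The centre `P` comes from an extremal convex combination `w` of the `q i`. Optimality of the weights
bounds the distance from `P` to every `q k` at once by the extremal value, and copositivity at those
weights bounds that value in terms of `R`. -/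

/-! ### Quadratic forms on the simplex and copositivity -/

/-- A quadratic form attains its maximum over the standard simplex at a point satisfying the
first order (Karush-Kuhn-Tucker) condition. -/
theorem exists_mem_stdSimplex_sum_mul_le {ι : Type*} [Fintype ι] [Nonempty ι]
    (M : ι → ι → ℝ) (hM : ∀ i j, M i j = M j i) :
    ∃ l : ι → ℝ, (∀ i, 0 ≤ l i) ∧ ∑ i, l i = 1 ∧
      ∀ k, ∑ j, l j * M j k ≤ ∑ i, ∑ j, l i * l j * M i j := by
  classical
  have hcont : Continuous fun l : ι → ℝ => ∑ i, ∑ j, l i * l j * M i j := by fun_prop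
  obtain ⟨l, hl, hmax⟩ := (isCompact_stdSimplex ℝ ι).exists_isMaxOn
    ⟨_, single_mem_stdSimplex ℝ (Classical.arbitrary ι)⟩ hcont.continuousOn
  refine ⟨l, hl.1, hl.2, fun k => ?_⟩
  set F := ∑ i, ∑ j, l i * l j * M i j with hF
  set m := ∑ j, l j * M j k with hm
  set e : ι → ℝ := Pi.single k 1 with he
  -- Maximality of `l` against the segment towards the vertex `k`, divided by `s`; as `s` tends to
  -- `0` it gives `m ≤ F`.
  have key : ∀ s : ℝ, 0 < s → s ≤ 1 → 2 * (m - F) + s * (F - 2 * m + M k k) ≤ 0 := by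
    intro s hs hs1
    have hmem := (convex_stdSimplex ℝ ι) hl (single_mem_stdSimplex ℝ k)
      (sub_nonneg.2 hs1) hs.le (by ring)
    have h := hmax hmem
    have hexp : (∑ i, ∑ j, ((1 - s) • l + s • e) i *
        ((1 - s) • l + s • e) j * M i j) =
        (1 - s) ^ 2 * F + 2 * s * (1 - s) * m + s ^ 2 * M k k := by
      have h1 : ∀ i j, ((1 - s) • l + s • e) i *
          ((1 - s) • l + s • e) j * M i j =
          (1 - s) ^ 2 * (l i * l j * M i j)
          + s * (1 - s) * (l i * e j * M i j)
          + s * (1 - s) * (e i * (l j * M j i))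
          + s ^ 2 * (e i *
            (e j * M i j)) := by
        intro i j
        rw [hM j i]
        simp only [Pi.add_apply, Pi.smul_apply, smul_eq_mul]
        ring
      simp only [h1, Finset.sum_add_distrib, ← Finset.mul_sum]
      simp [he, Pi.single_apply, ← hF, ← hm]
      ring
    have h' : (1 - s) ^ 2 * F + 2 * s * (1 - s) * m + s ^ 2 * M k k ≤ F := hexp ▸ h
    have : s * (2 * (m - F) + s * (F - 2 * m + M k k)) ≤ 0 := by nlinarith
    exact nonpos_of_mul_nonpos_right this hs
  by_contra! hlt
  set d := |F - 2 * m + M k k| with hd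
  have hpos : 0 < m - F := sub_pos.2 hlt
  have hden : 0 < m - F + d := add_pos_of_pos_of_nonneg hpos (abs_nonneg _)
  -- This `s` lies in `(0, 1]` and satisfies `s * d ≤ m - F`, so the second-order term cannot cancel
  -- `2 * (m - F)`.
  have h := key ((m - F) / (m - F + d)) (div_pos hpos hden)
    ((div_le_one hden).2 (le_add_of_nonneg_right (abs_nonneg _)))
  have hs : (m - F) / (m - F + d) * d ≤ m - F := by
    rw [div_mul_eq_mul_div, div_le_iff₀ hden]
    nlinarith [abs_nonneg (F - 2 * m + M k k)]
  have habs : -((m - F) / (m - F + d) * d) ≤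
      (m - F) / (m - F + d) * (F - 2 * m + M k k) := by
    rw [← mul_neg]
    exact mul_le_mul_of_nonneg_left (neg_abs_le _) (div_pos hpos hden).le
  linarith

/-- Three angles in `[0, π]` with sum at most `2π` can be enlarged to the angles between three
vectors of the plane. -/
theorem exists_cos_le_of_add_le_two_pi {α β γ : ℝ} (hα : 0 ≤ α)
    (hβ : 0 ≤ β) (hγ : 0 ≤ γ) (h : α + β + γ ≤ 2 * Real.pi) :
    ∃ s t, Real.cos s ≤ Real.cos α ∧ Real.cos t ≤ Real.cos β ∧
      Real.cos (s + t) ≤ Real.cos γ := by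
  rcases le_total Real.pi (α + β) with hc | hc
  · refine ⟨α, β, le_rfl, le_rfl, ?_⟩
    rw [← Real.cos_two_pi_sub]
    exact Real.cos_le_cos_of_nonneg_of_le_pi hγ (by linarith) (by linarith)
  -- Here `β` can grow to `π - α`, making the third angle `π`, whose cosine is minimal.
  · refine ⟨α, Real.pi - α, le_rfl,
      Real.cos_le_cos_of_nonneg_of_le_pi hβ (by linarith) (by linarith), ?_⟩
    rw [add_sub_cancel, Real.cos_pi]
    exact Real.neg_one_le_cos γ

/-- Vectors of lengths `s i` in the plane at directions `0`, `u`, `u + t` have a Gram matrix below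
`G` entrywise. For nonnegative weights the form of `G` is thus at least the squared norm of a
vector. -/
theorem copositive_of_angle_sum_le {G : Fin 3 → Fin 3 → ℝ} (hG : ∀ i j, G i j = G j i)
    {s : Fin 3 → ℝ} (hs : ∀ i, 0 ≤ s i) (hd : ∀ i, s i ^ 2 ≤ G i i) {α β γ : ℝ}
    (hα : 0 ≤ α) (hβ : 0 ≤ β) (hγ : 0 ≤ γ)
    (hsum : α + β + γ ≤ 2 * Real.pi) (h01 : s 0 * s 1 * Real.cos α ≤ G 0 1)
    (h12 : s 1 * s 2 * Real.cos β ≤ G 1 2) (h20 : s 2 * s 0 * Real.cos γ ≤ G 2 0)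
    {l : Fin 3 → ℝ} (hl : ∀ i, 0 ≤ l i) : 0 ≤ ∑ i, ∑ j, l i * l j * G i j := by
  obtain ⟨u, t, hu, ht, hut⟩ := exists_cos_le_of_add_le_two_pi hα hβ hγ hsum
  have e01 := mul_le_mul_of_nonneg_left
    ((mul_le_mul_of_nonneg_left hu (mul_nonneg (hs 0) (hs 1))).trans h01)
    (mul_nonneg (hl 0) (hl 1))
  have e12 := mul_le_mul_of_nonneg_left
    ((mul_le_mul_of_nonneg_left ht (mul_nonneg (hs 1) (hs 2))).trans h12)
    (mul_nonneg (hl 1) (hl 2))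
  have e20 := mul_le_mul_of_nonneg_left
    ((mul_le_mul_of_nonneg_left hut (mul_nonneg (hs 2) (hs 0))).trans h20)
    (mul_nonneg (hl 2) (hl 0))
  have e := fun i => mul_le_mul_of_nonneg_left (hd i) (sq_nonneg (l i))
  have key : 0 ≤ (l 0 * s 0 + l 1 * s 1 * Real.cos u + l 2 * s 2 * Real.cos (u + t)) ^ 2 +
      (l 1 * s 1 * Real.sin u + l 2 * s 2 * Real.sin (u + t)) ^ 2 := by positivity
  have hcos : Real.cos u * Real.cos (u + t) + Real.sin u * Real.sin (u + t) = Real.cos t := by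
    rw [← Real.cos_sub, ← Real.cos_neg]
    congr 1
    ring
  have h1 := Real.sin_sq_add_cos_sq u
  have h2 := Real.sin_sq_add_cos_sq (u + t)
  have hexp : (l 0 * s 0 + l 1 * s 1 * Real.cos u + l 2 * s 2 * Real.cos (u + t)) ^ 2 +
      (l 1 * s 1 * Real.sin u + l 2 * s 2 * Real.sin (u + t)) ^ 2 =
      l 0 ^ 2 * s 0 ^ 2 + l 1 ^ 2 * s 1 ^ 2 + l 2 ^ 2 * s 2 ^ 2 +
      2 * (l 0 * l 1 * (s 0 * s 1 * Real.cos u)) + 2 * (l 1 * l 2 * (s 1 * s 2 * Real.cos t)) +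
      2 * (l 2 * l 0 * (s 2 * s 0 * Real.cos (u + t))) := by
    rw [← hcos]
    linear_combination (l 1 ^ 2 * s 1 ^ 2) * h1 + (l 2 ^ 2 * s 2 ^ 2) * h2
  simp only [Fin.sum_univ_three]
  rw [hG 1 0, hG 2 1, hG 0 2]
  linarith [e 0, e 1, e 2]

/-- `Real.arccos` clamps its argument to `[-1, 1]`; clamping from above only decreases the cosine,
so one bound on `N` suffices. For model angles, that bound is the triangle inequality. -/
theorem mul_cos_arccos_div_le {N D : ℝ} (hD : 0 < D) (h : -D ≤ N) :
    D * Real.cos (Real.arccos (N / D)) ≤ N := by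
  rcases le_total N D with h' | h'
  · rw [Real.cos_arccos (by rwa [le_div_iff₀ hD, neg_one_mul]) ((div_le_one hD).2 h'),
      mul_div_cancel₀ _ hD.ne']
  · exact (mul_le_of_le_one_right hD.le (Real.cos_le_one _)).trans h'

/-! ### Law of cosines for model angles, as an inequality -/

section ModelAngle

variable {X : Type*} [MetricSpace X] {κ : ℝ}

theorem modelAngle_nonneg (p x y : X) : 0 ≤ modelAngle κ p x y := by
  unfold modelAngle
  dsimp only
  split_ifs <;> exact Real.arccos_nonneg _

theorem sin_mul_sin_mul_cos_modelAngle_le (hκ : 0 < κ) {p x y : X} (hx : p ≠ x) (hy : p ≠ y)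
    (hx' : √κ * dist p x ≤ Real.pi / 2) (hy' : √κ * dist p y ≤ Real.pi / 2) :
    Real.sin (√κ * dist p x) * Real.sin (√κ * dist p y) * Real.cos (modelAngle κ p x y) ≤
      Real.cos (√κ * dist x y) - Real.cos (√κ * dist p x) * Real.cos (√κ * dist p y) := by
  have hk := Real.sqrt_pos.2 hκ
  have hpi := Real.pi_pos
  have hbx := mul_pos hk (dist_pos.2 hx)
  have hby := mul_pos hk (dist_pos.2 hy)
  unfold modelAngle
  dsimp only
  rw [if_pos hκ]
  refine mul_cos_arccos_div_le (mul_pos (Real.sin_pos_of_pos_of_lt_pi hbx (by linarith))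
    (Real.sin_pos_of_pos_of_lt_pi hby (by linarith))) ?_
  have htri : √κ * dist x y ≤ √κ * dist p x + √κ * dist p y := by
    rw [← mul_add]
    exact mul_le_mul_of_nonneg_left (dist_triangle_left x y p) hk.le
  have := Real.cos_le_cos_of_nonneg_of_le_pi (mul_nonneg hk.le dist_nonneg) (by linarith) htri
  rw [Real.cos_add] at this
  linarith

theorem mul_mul_cos_modelAngle_zero_le {p x y : X} (hx : p ≠ x) (hy : p ≠ y) :
    dist p x * dist p y * Real.cos (modelAngle 0 p x y) ≤
      (dist p x ^ 2 + dist p y ^ 2 - dist x y ^ 2) / 2 := by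
  have hbx := dist_pos.2 hx
  have hby := dist_pos.2 hy
  have htri := dist_triangle_left x y p
  have h : -(2 * dist p x * dist p y) ≤ dist p x ^ 2 + dist p y ^ 2 - dist x y ^ 2 := by
    nlinarith [dist_nonneg (x := x) (y := y)]
  have := mul_cos_arccos_div_le (by positivity) h
  unfold modelAngle
  dsimp only
  rw [if_neg (lt_irrefl _), if_pos rfl]
  linarith

theorem sinh_mul_sinh_mul_cos_modelAngle_le (hκ : κ < 0) {p x y : X} (hx : p ≠ x)
    (hy : p ≠ y) :
    Real.sinh (√(-κ) * dist p x) * Real.sinh (√(-κ) * dist p y) *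
        Real.cos (modelAngle κ p x y) ≤
      Real.cosh (√(-κ) * dist p x) * Real.cosh (√(-κ) * dist p y) -
        Real.cosh (√(-κ) * dist x y) := by
  have hk := Real.sqrt_pos.2 (neg_pos.2 hκ)
  have hbx := mul_pos hk (dist_pos.2 hx)
  have hby := mul_pos hk (dist_pos.2 hy)
  unfold modelAngle
  dsimp only
  rw [if_neg hκ.not_gt, if_neg hκ.ne]
  refine mul_cos_arccos_div_le (mul_pos (Real.sinh_pos_iff.2 hbx) (Real.sinh_pos_iff.2 hby)) ?_
  have htri : √(-κ) * dist x y ≤ √(-κ) * dist p x + √(-κ) * dist p y := by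
    rw [← mul_add]
    exact mul_le_mul_of_nonneg_left (dist_triangle_left x y p) hk.le
  have : Real.cosh (√(-κ) * dist x y) ≤ Real.cosh (√(-κ) * dist p x + √(-κ) * dist p y) := by
    rw [Real.cosh_le_cosh, abs_of_nonneg (mul_nonneg hk.le dist_nonneg),
      abs_of_nonneg (by linarith)]
    exact htri
  rw [Real.cosh_add] at this
  linarith

end ModelAngle

/-! ### The model plane as a unit sphere of a bilinear form -/

namespace ModelPlane

variable {κ : ℝ}

/-- The point of the ambient space `ℝ × ℝ²` underlying a point of the model plane. -/
def toProd (P : ModelPlane κ) : ℝ × EuclideanSpace ℝ (Fin 2) := (P.t, P.v)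

/-- The ambient bilinear form `t s + κ ⟪v, w⟫`, for which the model plane is a unit sphere. -/
noncomputable def form (κ : ℝ) : LinearMap.BilinForm ℝ (ℝ × EuclideanSpace ℝ (Fin 2)) :=
  LinearMap.mk₂ ℝ (fun u w => u.1 * w.1 + κ * inner ℝ u.2 w.2)
    (fun u u' w => by simp [inner_add_left]; ring)
    (fun c u w => by simp [inner_smul_left]; ring)
    (fun u w w' => by simp [inner_add_right]; ring)
    (fun c u w => by simp [inner_smul_right]; ring)

theorem form_apply (u w : ℝ × EuclideanSpace ℝ (Fin 2)) :
    form κ u w = u.1 * w.1 + κ * inner ℝ u.2 w.2 := rfl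

theorem form_comm (u w : ℝ × EuclideanSpace ℝ (Fin 2)) : form κ u w = form κ w u := by
  rw [form_apply, form_apply, mul_comm, real_inner_comm]

theorem form_apply_self (u : ℝ × EuclideanSpace ℝ (Fin 2)) :
    form κ u u = u.1 ^ 2 + κ * ‖u.2‖ ^ 2 := by
  rw [form_apply, real_inner_self_eq_norm_sq, sq u.1]

theorem form_toProd_self (P : ModelPlane κ) : form κ P.toProd P.toProd = 1 := by
  rw [form_apply_self]
  exact P.eqn

theorem form_self_nonneg (hκ : 0 < κ) (u : ℝ × EuclideanSpace ℝ (Fin 2)) :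
    0 ≤ form κ u u := by
  rw [form_apply_self]
  positivity

theorem form_self_pos (hκ : 0 < κ) {u : ℝ × EuclideanSpace ℝ (Fin 2)} (hu : u ≠ 0) :
    0 < form κ u u := by
  refine (form_self_nonneg hκ u).lt_of_ne' fun h => hu ?_
  rw [form_apply_self] at h
  have h1 : u.1 ^ 2 = 0 := le_antisymm (by nlinarith [sq_nonneg ‖u.2‖]) (sq_nonneg _)
  have h2 : ‖u.2‖ ^ 2 = 0 := by
    rw [h1, zero_add] at h
    exact (mul_eq_zero.1 h).resolve_left hκ.ne'
  exact Prod.ext (pow_eq_zero_iff two_ne_zero |>.1 h1)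
    (norm_eq_zero.1 (pow_eq_zero_iff two_ne_zero |>.1 h2))

theorem form_le_one (hκ : 0 < κ) (P Q : ModelPlane κ) : form κ P.toProd Q.toProd ≤ 1 := by
  have h := form_self_nonneg hκ (P.toProd - Q.toProd)
  simp only [map_sub, LinearMap.sub_apply, form_toProd_self, form_comm Q.toProd P.toProd] at h
  linarith

theorem neg_one_le_form (hκ : 0 < κ) (P Q : ModelPlane κ) :
    -1 ≤ form κ P.toProd Q.toProd := by
  have h := form_self_nonneg hκ (P.toProd + Q.toProd)
  simp only [map_add, LinearMap.add_apply, form_toProd_self, form_comm Q.toProd P.toProd] at h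
  linarith

/-- Reverse Cauchy-Schwarz inequality for vectors on the same sheet of the hyperboloid. -/
theorem one_le_form (hκ : κ < 0) (P Q : ModelPlane κ) : 1 ≤ form κ P.toProd Q.toProd := by
  have hP := P.eqn
  have hQ := Q.eqn
  have hi := real_inner_le_norm P.v Q.v
  have h : 1 - κ * (‖P.v‖ * ‖Q.v‖) ≤ P.t * Q.t := by
    refine abs_le_of_sq_le_sq' ?_ (mul_pos (P.pos hκ.le) (Q.pos hκ.le)).le |>.2
    have : (P.t * Q.t) ^ 2 = (1 - κ * ‖P.v‖ ^ 2) * (1 - κ * ‖Q.v‖ ^ 2) := by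
      linear_combination P.t ^ 2 * hQ + (1 - κ * ‖Q.v‖ ^ 2) * hP
    rw [this]
    nlinarith [mul_nonneg (neg_pos.2 hκ).le (sq_nonneg (‖P.v‖ - ‖Q.v‖))]
  have := mul_le_mul_of_nonpos_left hi hκ.le
  change 1 ≤ P.t * Q.t + κ * inner ℝ P.v Q.v
  linarith

theorem dist_of_pos (hκ : 0 < κ) (P Q : ModelPlane κ) :
    dist P Q = Real.arccos (form κ P.toProd Q.toProd) / √κ :=
  if_pos hκ

theorem dist_of_zero (P Q : ModelPlane 0) : dist P Q = ‖P.v - Q.v‖ :=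
  (if_neg (lt_irrefl _)).trans (if_pos rfl)

theorem dist_of_neg (hκ : κ < 0) (P Q : ModelPlane κ) :
    dist P Q = Real.arcosh (form κ P.toProd Q.toProd) / √(-κ) :=
  (if_neg hκ.not_gt).trans (if_neg hκ.ne)

theorem dist_nonneg' (P Q : ModelPlane κ) : 0 ≤ dist P Q := by
  rcases lt_trichotomy κ 0 with hκ | rfl | hκ
  · rw [dist_of_neg hκ]
    exact div_nonneg (Real.arcosh_nonneg (one_le_form hκ P Q)) (Real.sqrt_nonneg _)
  · rw [dist_of_zero]
    exact norm_nonneg _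
  · rw [dist_of_pos hκ]
    exact div_nonneg (Real.arccos_nonneg _) (Real.sqrt_nonneg _)

theorem dist_self' (P : ModelPlane κ) : dist P P = 0 := by
  rcases lt_trichotomy κ 0 with hκ | rfl | hκ
  · rw [dist_of_neg hκ, form_toProd_self, Real.arcosh_zero, zero_div]
  · rw [dist_of_zero, sub_self, norm_zero]
  · rw [dist_of_pos hκ, form_toProd_self, Real.arccos_one, zero_div]

theorem dist_comm' (P Q : ModelPlane κ) : dist P Q = dist Q P := by
  rcases lt_trichotomy κ 0 with hκ | rfl | hκ
  · rw [dist_of_neg hκ, dist_of_neg hκ, form_comm]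
  · rw [dist_of_zero, dist_of_zero, norm_sub_rev]
  · rw [dist_of_pos hκ, dist_of_pos hκ, form_comm]

theorem cos_dist (hκ : 0 < κ) (P Q : ModelPlane κ) :
    Real.cos (√κ * dist P Q) = form κ P.toProd Q.toProd := by
  rw [dist_of_pos hκ, mul_div_cancel₀ _ (Real.sqrt_pos.2 hκ).ne',
    Real.cos_arccos (neg_one_le_form hκ P Q) (form_le_one hκ P Q)]

theorem cosh_dist (hκ : κ < 0) (P Q : ModelPlane κ) :
    Real.cosh (√(-κ) * dist P Q) = form κ P.toProd Q.toProd := by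
  rw [dist_of_neg hκ, mul_div_cancel₀ _ (Real.sqrt_pos.2 (neg_pos.2 hκ)).ne',
    Real.cosh_arcosh (one_le_form hκ P Q)]

theorem dist_le_of_cos_le (hκ : 0 < κ) {P Q : ModelPlane κ} {R : ℝ} (hR : 0 ≤ R)
    (hR' : √κ * R ≤ Real.pi) (h : Real.cos (√κ * R) ≤ form κ P.toProd Q.toProd) :
    dist P Q ≤ R := by
  have hk := Real.sqrt_pos.2 hκ
  rw [dist_of_pos hκ, div_le_iff₀' hk]
  exact (Real.arccos_le_arccos h).trans_eq (Real.arccos_cos (mul_nonneg hk.le hR) hR')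

theorem dist_le_of_le_cosh (hκ : κ < 0) {P Q : ModelPlane κ} {R : ℝ} (hR : 0 ≤ R)
    (h : form κ P.toProd Q.toProd ≤ Real.cosh (√(-κ) * R)) : dist P Q ≤ R := by
  have hk := Real.sqrt_pos.2 (neg_pos.2 hκ)
  rw [dist_of_neg hκ, div_le_iff₀' hk, ← Real.arcosh_cosh (mul_nonneg hk.le hR),
    Real.arcosh_le_arcosh (zero_lt_one.trans_le (one_le_form hκ P Q)) (Real.cosh_pos _)]
  exact h

theorem exists_toProd_eq_smul {u : ℝ × EuclideanSpace ℝ (Fin 2)} (hu : 0 < form κ u u)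
    (hpos : κ ≤ 0 → 0 < u.1) : ∃ P : ModelPlane κ, P.toProd = (√(form κ u u))⁻¹ • u := by
  have hs := Real.sqrt_pos.2 hu
  refine ⟨⟨(√(form κ u u))⁻¹ * u.1, (√(form κ u u))⁻¹ • u.2, ?_,
    fun h => mul_pos (inv_pos.2 hs) (hpos h)⟩, rfl⟩
  rw [norm_smul, mul_pow, mul_pow, Real.norm_eq_abs, sq_abs, inv_pow, Real.sq_sqrt hu.le,
    mul_left_comm, ← mul_add, ← form_apply_self, inv_mul_cancel₀ hu.ne']

theorem form_sum_left {ι : Type*} [Fintype ι] (l : ι → ℝ) (q : ι → ModelPlane κ)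
    (u : ℝ × EuclideanSpace ℝ (Fin 2)) :
    form κ (∑ i, l i • (q i).toProd) u = ∑ i, l i * form κ (q i).toProd u := by
  simp

theorem form_sum_self {ι : Type*} [Fintype ι] (l : ι → ℝ) (q : ι → ModelPlane κ) :
    form κ (∑ i, l i • (q i).toProd) (∑ i, l i • (q i).toProd) =
      ∑ i, ∑ j, l i * l j * form κ (q i).toProd (q j).toProd := by
  rw [form_sum_left]
  refine Finset.sum_congr rfl fun i _ => ?_
  rw [form_comm, form_sum_left, Finset.mul_sum]
  refine Finset.sum_congr rfl fun j _ => ?_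
  rw [form_comm, mul_assoc]

/-- Any three points of a sphere lie in a closed hemisphere. -/
theorem exists_form_nonneg (hκ : 0 < κ) (q : Fin 3 → ModelPlane κ) :
    ∃ P : ModelPlane κ, ∀ i, 0 ≤ form κ P.toProd (q i).toProd := by
  obtain ⟨u, hu, h⟩ : ∃ u : ℝ × EuclideanSpace ℝ (Fin 2), u ≠ 0 ∧
      ∀ i, 0 ≤ form κ u (q i).toProd := by
    let f : (ℝ × EuclideanSpace ℝ (Fin 2)) →ₗ[ℝ] (Fin 3 → ℝ) :=
      LinearMap.pi fun i => (form κ).flip (q i).toProd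
    -- The ambient space has dimension 3: either all three values can be prescribed to be `1`, or a
    -- nonzero vector is orthogonal to all three points.
    by_cases hf : Function.Injective f
    · obtain ⟨u, hu⟩ := (LinearMap.injective_iff_surjective_of_finrank_eq_finrank
        (by simp)).1 hf 1
      refine ⟨u, ?_, fun i => ?_⟩
      · rintro rfl
        rw [map_zero] at hu
        exact zero_ne_one hu
      · have : form κ u (q i).toProd = 1 := congrFun hu i
        rw [this]
        exact zero_le_one
    · rw [injective_iff_map_eq_zero] at hf
      push Not at hf
      obtain ⟨u, hu, hne⟩ := hf
      exact ⟨u, hne, fun i => (congrFun hu i : form κ u (q i).toProd = 0).ge⟩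
  have hpos := form_self_pos hκ hu
  obtain ⟨P, hP⟩ := exists_toProd_eq_smul hpos fun h => absurd h hκ.not_ge
  refine ⟨P, fun i => ?_⟩
  rw [hP, map_smul, LinearMap.smul_apply, smul_eq_mul]
  exact mul_nonneg (inv_nonneg.2 (Real.sqrt_nonneg _)) (h i)

/-! ### Centres from copositivity, one curvature sign at a time -/

variable {ι : Type*} [Fintype ι] [Nonempty ι]

/-- Let `w` minimise the form over the convex hull of the `q i`. Optimality gives `form w (q k) ≥
form w w`, and copositivity gives `form w w ≥ (∑ l i * c i) ^ 2 ≥ C ^ 2`; normalise `w`. -/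
theorem exists_le_form_of_copositive (hκ : 0 < κ) (q : ι → ModelPlane κ) {c : ι → ℝ} {C : ℝ}
    (hC : 0 < C) (hc : ∀ i, C ≤ c i)
    (h : ∀ l : ι → ℝ, (∀ i, 0 ≤ l i) → 0 ≤ ∑ i, ∑ j, l i * l j *
      (form κ (q i).toProd (q j).toProd - c i * c j)) :
    ∃ P : ModelPlane κ, ∀ i, C ≤ form κ P.toProd (q i).toProd := by
  obtain ⟨l, hl, hl1, hk⟩ := exists_mem_stdSimplex_sum_mul_le
    (fun i j => -form κ (q i).toProd (q j).toProd) fun i j => by rw [form_comm]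
  simp only [mul_neg, Finset.sum_neg_distrib, neg_le_neg_iff] at hk
  simp only [← form_sum_self, ← form_sum_left] at hk
  set w := ∑ i, l i • (q i).toProd
  have hCc : C ≤ ∑ i, l i * c i := by
    calc C = ∑ i, l i * C := by rw [← Finset.sum_mul, hl1, one_mul]
      _ ≤ _ := Finset.sum_le_sum fun i _ => mul_le_mul_of_nonneg_left (hc i) (hl i)
  have hww : C ^ 2 ≤ form κ w w := by
    refine (pow_le_pow_left₀ hC.le hCc 2).trans ?_
    have h' := h l hl
    simp only [mul_sub, Finset.sum_sub_distrib] at h'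
    rw [← form_sum_self, sub_nonneg] at h'
    refine le_of_eq_of_le ?_ h'
    rw [sq, Finset.sum_mul_sum]
    exact Finset.sum_congr rfl fun i _ => Finset.sum_congr rfl fun j _ => by ring
  have hpos : 0 < form κ w w := (pow_pos hC 2).trans_le hww
  obtain ⟨P, hP⟩ := exists_toProd_eq_smul hpos fun h => absurd h hκ.not_ge
  refine ⟨P, fun i => ?_⟩
  rw [hP, map_smul, LinearMap.smul_apply, smul_eq_mul]
  calc C ≤ √(form κ w w) := Real.le_sqrt_of_sq_le hww
    _ = (√(form κ w w))⁻¹ * form κ w w := by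
      rw [eq_inv_mul_iff_mul_eq₀ (Real.sqrt_pos.2 hpos).ne', Real.mul_self_sqrt hpos.le]
    _ ≤ _ := mul_le_mul_of_nonneg_left (hk i) (inv_nonneg.2 (Real.sqrt_nonneg _))

/-- The spherical argument with inequalities reversed: `w` maximises the form. It also has to be
timelike and on the upper sheet in order to be normalised. -/
theorem exists_form_le_of_copositive (hκ : κ < 0) (q : ι → ModelPlane κ) {c : ι → ℝ} {C : ℝ}
    (hc0 : ∀ i, 0 ≤ c i) (hc : ∀ i, c i ≤ C)
    (h : ∀ l : ι → ℝ, (∀ i, 0 ≤ l i) → 0 ≤ ∑ i, ∑ j, l i * l j *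
      (c i * c j - form κ (q i).toProd (q j).toProd)) :
    ∃ P : ModelPlane κ, ∀ i, form κ P.toProd (q i).toProd ≤ C := by
  obtain ⟨l, hl, hl1, hk⟩ := exists_mem_stdSimplex_sum_mul_le
    (fun i j => form κ (q i).toProd (q j).toProd) fun i j => by rw [form_comm]
  have hpos : 0 < ∑ i, ∑ j, l i * l j * form κ (q i).toProd (q j).toProd := by
    have : ∑ i, ∑ j, l i * l j = 1 := by rw [← Finset.sum_mul_sum, hl1, one_mul]
    refine (this ▸ zero_lt_one).trans_le (Finset.sum_le_sum fun i _ =>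
      Finset.sum_le_sum fun j _ => ?_)
    exact le_mul_of_one_le_right (mul_nonneg (hl i) (hl j)) (one_le_form hκ _ _)
  obtain ⟨i₀, hi₀⟩ : ∃ i, 0 < l i := by
    by_contra! hneg
    have := Finset.sum_nonpos fun i (_ : i ∈ Finset.univ) => hneg i
    linarith
  have hw1 : 0 < (∑ i, l i • (q i).toProd).1 := by
    rw [Prod.fst_sum]
    exact Finset.sum_pos' (fun i _ => mul_nonneg (hl i) ((q i).pos hκ.le).le)
      ⟨i₀, Finset.mem_univ _, mul_pos hi₀ ((q i₀).pos hκ.le)⟩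
  rw [← form_sum_self] at hpos
  simp only [← form_sum_self, ← form_sum_left] at hk
  set w := ∑ i, l i • (q i).toProd
  have hCc : ∑ i, l i * c i ≤ C := by
    calc _ ≤ ∑ i, l i * C :=
          Finset.sum_le_sum fun i _ => mul_le_mul_of_nonneg_left (hc i) (hl i)
      _ = C := by rw [← Finset.sum_mul, hl1, one_mul]
  have hc' : 0 ≤ ∑ i, l i * c i := Finset.sum_nonneg fun i _ => mul_nonneg (hl i) (hc0 i)
  have hww : form κ w w ≤ C ^ 2 := by
    refine le_trans ?_ (pow_le_pow_left₀ hc' hCc 2)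
    have h' := h l hl
    simp only [mul_sub, Finset.sum_sub_distrib] at h'
    rw [← form_sum_self, sub_nonneg] at h'
    refine le_of_le_of_eq h' ?_
    rw [sq, Finset.sum_mul_sum]
    exact Finset.sum_congr rfl fun i _ => Finset.sum_congr rfl fun j _ => by ring
  obtain ⟨P, hP⟩ := exists_toProd_eq_smul hpos fun _ => hw1
  refine ⟨P, fun i => ?_⟩
  rw [hP, map_smul, LinearMap.smul_apply, smul_eq_mul]
  calc _ ≤ (√(form κ w w))⁻¹ * form κ w w :=
        mul_le_mul_of_nonneg_left (hk i) (inv_nonneg.2 (Real.sqrt_nonneg _))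
    _ = √(form κ w w) := by
      rw [inv_mul_eq_iff_eq_mul₀ (Real.sqrt_pos.2 hpos).ne', Real.mul_self_sqrt hpos.le]
    _ ≤ C := Real.sqrt_le_iff.2 ⟨hc'.trans hCc, hww⟩

/-- The centre is the barycentre `w` for weights maximising the mean squared distance `F`.
Optimality reads `F / 2 + ‖w - q k‖ ^ 2 ≤ F`, and copositivity gives `F ≤ 2 * R ^ 2`. -/
theorem exists_dist_le_of_copositive (q : ι → ModelPlane 0) {r : ι → ℝ} {R : ℝ}
    (hr0 : ∀ i, 0 ≤ r i) (hr : ∀ i, r i ≤ R)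
    (h : ∀ l : ι → ℝ, (∀ i, 0 ≤ l i) → 0 ≤ ∑ i, ∑ j, l i * l j *
      ((r i ^ 2 + r j ^ 2 - dist (q i) (q j) ^ 2) / 2)) :
    ∃ P : ModelPlane 0, ∀ i, dist P (q i) ≤ R := by
  obtain ⟨l, hl, hl1, hk⟩ := exists_mem_stdSimplex_sum_mul_le
    (fun i j => dist (q i) (q j) ^ 2) fun i j => by rw [dist_comm']
  set F := ∑ i, ∑ j, l i * l j * dist (q i) (q j) ^ 2 with hF
  set w := ∑ i, l i • (q i).v with hw
  have hR : 0 ≤ R := (hr0 (Classical.arbitrary ι)).trans (hr _)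
  have hFR : F ≤ 2 * R ^ 2 := by
    have hle : ∀ i j, l i * l j * ((r i ^ 2 + r j ^ 2 - dist (q i) (q j) ^ 2) / 2) ≤
        l i * l j * R ^ 2 - l i * l j * dist (q i) (q j) ^ 2 / 2 := fun i j => by
      have hi := pow_le_pow_left₀ (hr0 i) (hr i) 2
      have hj := pow_le_pow_left₀ (hr0 j) (hr j) 2
      rw [mul_div_assoc, ← mul_sub]
      exact mul_le_mul_of_nonneg_left (by linarith) (mul_nonneg (hl i) (hl j))
    have h' := (h l hl).trans (Finset.sum_le_sum fun i _ => Finset.sum_le_sum fun j _ => hle i j)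
    simp only [Finset.sum_sub_distrib, ← Finset.sum_div, ← Finset.sum_mul] at h'
    rw [← Finset.sum_mul_sum, hl1, ← hF] at h'
    linarith
  -- Parallel axis identity for the barycentre `w`.
  have hexp : ∀ u, ∑ j, l j * ‖(q j).v - u‖ ^ 2 = ∑ j, l j * ‖(q j).v - w‖ ^ 2 + ‖w - u‖ ^ 2 := by
    intro u
    have h0 : ∑ j, l j * inner ℝ ((q j).v - w) (w - u) = 0 := by
      simp only [← real_inner_smul_left]
      rw [← sum_inner]
      simp only [smul_sub, Finset.sum_sub_distrib, ← Finset.sum_smul]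
      rw [hl1, one_smul, ← hw, sub_self, inner_zero_left]
    have h1 : ∀ j, l j * ‖(q j).v - u‖ ^ 2 = l j * ‖(q j).v - w‖ ^ 2 +
        2 * (l j * inner ℝ ((q j).v - w) (w - u)) + l j * ‖w - u‖ ^ 2 := fun j => by
      rw [← sub_add_sub_cancel (q j).v w u, norm_add_sq_real]
      ring
    simp only [h1, Finset.sum_add_distrib, ← Finset.mul_sum, ← Finset.sum_mul]
    rw [h0, hl1]
    ring
  have hV : F = 2 * ∑ j, l j * ‖(q j).v - w‖ ^ 2 := by
    have h2 : F = ∑ i, l i * ∑ j, l j * ‖(q j).v - (q i).v‖ ^ 2 := by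
      rw [hF]
      refine Finset.sum_congr rfl fun i _ => ?_
      rw [Finset.mul_sum]
      exact Finset.sum_congr rfl fun j _ => by rw [dist_of_zero, norm_sub_rev, mul_assoc]
    simp only [fun i => hexp (q i).v, mul_add, Finset.sum_add_distrib, ← Finset.sum_mul] at h2
    rw [hl1] at h2
    simp only [norm_sub_rev w] at h2
    linarith
  refine ⟨⟨1, w, by simp, fun _ => one_pos⟩, fun k => ?_⟩
  rw [dist_of_zero]
  refine abs_le_of_sq_le_sq' ?_ hR |>.2
  have h3 := hk k
  simp only [dist_of_zero] at h3
  rw [hexp] at h3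
  change ‖w - (q k).v‖ ^ 2 ≤ R ^ 2
  linarith

end ModelPlane

/-! ### Comparison of circumradii -/

section Circumradius

variable {X : Type*} [MetricSpace X] {κ : ℝ}

open ModelPlane

/-- In a space satisfying the four-point condition, a matrix bounded below by
`s i * s j * cos (modelAngle κ x (p i) (p j))` is copositive. -/
theorem IsCBB.copositive (hX : IsCBB κ X) {p : Fin 3 → X} {x : X} (hp : ∀ i, x ≠ p i)
    (hsmall : ∀ i j, IsSmallTriangle κ x (p i) (p j)) {G : Fin 3 → Fin 3 → ℝ}
    (hG : ∀ i j, G i j = G j i) {s : Fin 3 → ℝ} (hs : ∀ i, 0 ≤ s i)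
    (hd : ∀ i, s i ^ 2 ≤ G i i)
    (h : ∀ i j, s i * s j * Real.cos (modelAngle κ x (p i) (p j)) ≤ G i j)
    (l : Fin 3 → ℝ) (hl : ∀ i, 0 ≤ l i) : 0 ≤ ∑ i, ∑ j, l i * l j * G i j :=
  copositive_of_angle_sum_le hG hs hd (modelAngle_nonneg _ _ _) (modelAngle_nonneg _ _ _)
    (modelAngle_nonneg _ _ _) (hX.four_point x (p 0) (p 1) (p 2) (hp 0) (hp 1) (hp 2)
      (hsmall 0 1) (hsmall 1 2) (hsmall 2 0)) (h 0 1) (h 1 2) (h 2 0) hl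

theorem IsCBB.exists_dist_le (hX : IsCBB κ X) {p : Fin 3 → X} {q : Fin 3 → ModelPlane κ}
    (hpq : ∀ i j, dist (q i) (q j) = dist (p i) (p j)) {x : X} {R : ℝ}
    (hR : ∀ i, dist x (p i) ≤ R) : ∃ P : ModelPlane κ, ∀ i, dist P (q i) ≤ R := by
  have hR0 : 0 ≤ R := dist_nonneg.trans (hR 0)
  by_cases hp : ∀ i, x ≠ p i
  swap
  -- Angles at `x` are undefined when `x` is a vertex, but then the corresponding `q i` is a centre.
  · push Not at hp
    obtain ⟨i, rfl⟩ := hp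
    exact ⟨q i, fun j => (hpq i j).trans_le (hR j)⟩
  rcases lt_trichotomy κ 0 with hκ | rfl | hκ
  · have hk := Real.sqrt_pos.2 (neg_pos.2 hκ)
    obtain ⟨P, hP⟩ := exists_form_le_of_copositive hκ q
      (c := fun i => Real.cosh (√(-κ) * dist x (p i))) (C := Real.cosh (√(-κ) * R))
      (fun i => (Real.cosh_pos _).le)
      (fun i => by
        rw [Real.cosh_le_cosh, abs_of_nonneg (mul_nonneg hk.le dist_nonneg),
          abs_of_nonneg (mul_nonneg hk.le hR0)]
        exact mul_le_mul_of_nonneg_left (hR i) hk.le)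
      (hX.copositive hp (fun i j h => absurd h hκ.not_gt)
        (s := fun i => Real.sinh (√(-κ) * dist x (p i)))
        (fun i j => by rw [form_comm, mul_comm (Real.cosh _)])
        (fun i => Real.sinh_nonneg_iff.2 (mul_nonneg hk.le dist_nonneg))
        (fun i => by rw [form_toProd_self, Real.sinh_sq, sq])
        (fun i j => by
          rw [← cosh_dist hκ, hpq]
          exact sinh_mul_sinh_mul_cos_modelAngle_le hκ (hp i) (hp j)))
    exact ⟨P, fun i => dist_le_of_le_cosh hκ hR0 (hP i)⟩
  · exact exists_dist_le_of_copositive q (r := fun i => dist x (p i)) (fun i => dist_nonneg) hR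
      (hX.copositive hp (fun i j h => absurd h (lt_irrefl _))
        (s := fun i => dist x (p i))
        (fun i j => by rw [dist_comm', add_comm (dist x (p i) ^ 2)])
        (fun i => dist_nonneg)
        (fun i => by rw [dist_self']; linarith)
        (fun i j => by
          rw [hpq]
          exact mul_mul_cos_modelAngle_zero_le (hp i) (hp j)))
  · have hk := Real.sqrt_pos.2 hκ
    have hpi := Real.pi_pos
    -- A radius of at least a quarter of a great circle always suffices, by the hemisphere lemma.
    -- Below it the cosines are positive, and the triangles at `x`, of perimeter at most `4 * R`,
    -- are not large.
    rcases le_or_gt (Real.pi / 2) (√κ * R) with hlarge | hlt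
    · obtain ⟨P, hP⟩ := exists_form_nonneg hκ q
      refine ⟨P, fun i => ?_⟩
      rw [dist_of_pos hκ, div_le_iff₀' hk]
      exact (Real.arccos_le_pi_div_two.2 (hP i)).trans hlarge
    have hr : ∀ i, √κ * dist x (p i) ≤ √κ * R := fun i =>
      mul_le_mul_of_nonneg_left (hR i) hk.le
    have hr0 : ∀ i, 0 ≤ √κ * dist x (p i) := fun i => mul_nonneg hk.le dist_nonneg
    obtain ⟨P, hP⟩ := exists_le_form_of_copositive hκ q
      (c := fun i => Real.cos (√κ * dist x (p i))) (C := Real.cos (√κ * R))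
      (Real.cos_pos_of_mem_Ioo ⟨by linarith [mul_nonneg hk.le hR0], hlt⟩)
      (fun i => Real.cos_le_cos_of_nonneg_of_le_pi (hr0 i) (by linarith) (hr i))
      (hX.copositive hp
        (fun i j _ => by
          rw [lt_div_iff₀' hk, dist_comm (p j) x]
          have := mul_le_mul_of_nonneg_left (dist_triangle_left (p i) (p j) x) hk.le
          linarith [hr i, hr j])
        (s := fun i => Real.sin (√κ * dist x (p i)))
        (fun i j => by rw [form_comm, mul_comm (Real.cos _)])
        (fun i => Real.sin_nonneg_of_nonneg_of_le_pi (hr0 i) (by linarith [hr i]))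
        (fun i => by rw [form_toProd_self, Real.sin_sq, sq])
        (fun i j => by
          rw [← cos_dist hκ, hpq]
          exact sin_mul_sin_mul_cos_modelAngle_le hκ (hp i) (hp j)
            ((hr i).trans hlt.le) ((hr j).trans hlt.le)))
    exact ⟨P, fun i => dist_le_of_cos_le hκ hR0 (by linarith) (hP i)⟩

end Circumradius

theorem mainTheorem5 (κ : ℝ) (X : Type*) [MetricSpace X] (hX : IsCBB κ X) : CurvGE κ X := by
  intro a b c _ a' b' c' ⟨hab, hbc, hca⟩
  have : Nonempty X := ⟨a⟩
  refine le_ciInf fun x => ?_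
  have hpq : ∀ i j, dist (![a', b', c'] i) (![a', b', c'] j) =
      dist (![a, b, c] i) (![a, b, c] j) := by
    have hba := (ModelPlane.dist_comm' b' a').trans (hab.trans (dist_comm a b))
    have hcb := (ModelPlane.dist_comm' c' b').trans (hbc.trans (dist_comm b c))
    have hac := (ModelPlane.dist_comm' a' c').trans (hca.trans (dist_comm c a))
    intro i j
    fin_cases i <;> fin_cases j <;>
      simp [ModelPlane.dist_self', hab, hbc, hca, hba, hcb, hac]
  have hR : ∀ i, dist x (![a, b, c] i) ≤ max (dist x a) (max (dist x b) (dist x c)) := by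
    intro i
    fin_cases i <;> simp
  obtain ⟨P, hP⟩ := hX.exists_dist_le hpq hR
  -- A real infimum is below its values only for a family bounded below; here `0` is a bound.
  refine (ciInf_le ⟨0, ?_⟩ P).trans (max_le (hP 0) (max_le (hP 1) (hP 2)))
  rintro _ ⟨Q, rfl⟩
  exact (ModelPlane.dist_nonneg' Q a').trans (le_max_left _ _)
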